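/- Notation. Let $dA(z)=d^2z/\pi$ on $\mathbb{C}$. For a weight $\omega:\mathbb{C}\to[0,\infty)$ and $n\ge 0$ put $$\Delta_n^{\omega}(u_1,\dots,u_n)=\prod_{1\le j<l\le n}|u_j-u_l|^2|u_j-\overline{u}_l|^2\prod_{j=1}^n|u_j-\overline{u}_j|^2\,\omega(u_j),\qquad Z_n^{\omega}=\int_{\mathbb{C}^n}\Delta_n^{\omega}(u)\prod_{j=1}^n dA(u_j)$$ (so $Z_0^\omega=1$). Let $\omega^{(\mathrm g)}(z)=e^{-2|z|^2}$ and, for $z_1\in\mathbb{C}$, let $\omega^{(\mathrm{over})}(z)=\omega^{(\mathrm{over})}(z|z_1)=|z-\overline{z}_1|^2(1+|z-z_1|^2)e^{-2|z|^2}$. Write $Z_N^{(\mathrm g)}=Z_N^{\omega^{(\mathrm g)}}$ and $Z_{N-1}^{(\mathrm{over})}(z_1)=Z_{N-1}^{\omega^{(\mathrm{over})}(\cdot|z_1)}$. For $1\le k\le N$ the generalised mean diagonal overlap of the symplectic Ginibre ensemble (GinSE) is $$D_{1,1}^{(N,k)}(z_1,\dots,z_k)=\frac{N!}{(N-k)!}\,\frac{1}{Z_N^{(\mathrm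 g)}}\,|z_1-\overline{z}_1|^2e^{-2|z_1|^2}\int_{\mathbb{C}^{N-k}}\Delta_{N-1}^{\omega^{(\mathrm{over})}(\cdot|z_1)}(z_2,\dots,z_N)\prod_{j=k+1}^N dA(z_j).$$ For polynomials $f,g\in\mathbb{C}[z]$ and a weight $\omega$ let $$\langle f,g\rangle_s=\int_{\mathbb{C}}\bigl(f(z)g(\overline z)-g(z)f(\overline z)\bigr)(z-\overline z)\,\omega(z)\,dA(z)$$ (for real coefficients, $g(\overline z)=\overline{g(z)}$ and $f(\overline z)=\overline{f(z)}$). A sequence $(q_k)_{k\ge0}$ of polynomials with $\deg q_k=k$ is called skew-orthogonal for $\omega$, with skew-norms $r_k>0$, if for all $k,l\ge 0$ $$\langle q_{2k},q_{2l}\rangle_s=\langle q_{2k+1},q_{2l+1}\rangle_s=0,\qquad \langle q_{2k},q_{2l+1}\rangle_s=-\langle q_{2l+1},q_{2k}\rangle_s=r_k\delta_{k,l}.$$ The corresponding skew-kernel is $$\varkappa_n(z,w)=\sum_{k=0}^{n-1}\frac{q_{2k+1}(z)q_{2k}(w)-q_{2k}(z)q_{2k+1}(w)}{r_k}.$$ The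 Pfaffian of a skew-symmetric $2n\times2n$ matrix $A$ is $\mathrm{Pf}\,A=\frac{1}{2^nn!}\sum_{\sigma\in S_{2n}}\mathrm{sgn}(\sigma)\prod_{i=1}^nA_{\sigma(2i-1),\sigma(2i)}$. Lemma (Pfaffian structure of the mean diagonal overlap). Let $N\ge1$ and $z_1\in\mathbb{C}$. (i) For $k=1$, $$D_{1,1}^{(N,1)}(z_1)=\frac{N\,Z_{N-1}^{(\mathrm{over})}(z_1)}{Z_N^{(\mathrm g)}}\,|z_1-\overline z_1|^2e^{-2|z_1|^2}.$$ (ii) Skew-orthogonal polynomials for $\omega^{(\mathrm{over})}(\cdot|z_1)$ exist. For every such family, with skew-kernel $\varkappa_{N-1}^{(\mathrm{over})}(\cdot,\cdot)=\varkappa_{N-1}^{(\mathrm{over})}(\cdot,\cdot|z_1,\overline z_1)$, every $2\le k\le N$ and all $z_2,\dots,z_k\in\mathbb{C}$, $$D_{1,1}^{(N,k)}(z_1,\dots,z_k)=\frac{N\,Z_{N-1}^{(\mathrm{over})}(z_1)}{Z_N^{(\mathrm g)}}\,|z_1-\overline z_1|^2e^{-2|z_1|^2}\prod_{j=2}^k(\overline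 z_j-z_j)\,\omega^{(\mathrm{over})}(z_j|z_1)\;\mathrm{Pf}\left[\begin{pmatrix}\varkappa_{N-1}^{(\mathrm{over})}(z_j,z_\ell)&\varkappa_{N-1}^{(\mathrm{over})}(z_j,\overline z_\ell)\\ \varkappa_{N-1}^{(\mathrm{over})}(\overline z_j,z_\ell)&\varkappa_{N-1}^{(\mathrm{over})}(\overline z_j,\overline z_\ell)\end{pmatrix}\right]_{j,\ell=2}^k.$$ -/

import Mathlib

open scoped ComplexConjugate

noncomputable section

namespace GinSE

/-- The area measure `dA(z) = d²z / π` on the complex plane. -/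
def dA : MeasureTheory.Measure ℂ :=
  (NNReal.pi⁻¹ : NNReal) • (MeasureTheory.volume : MeasureTheory.Measure ℂ)

instance : MeasureTheory.SigmaFinite dA := by
  unfold dA
  infer_instance

/-- The product measure `dA(z_1) ⋯ dA(z_n)` on `ℂ^n`. -/
def dAn (n : ℕ) : MeasureTheory.Measure (Fin n → ℂ) :=
  MeasureTheory.Measure.pi (fun _ => dA)

/-- The unnormalised joint eigenvalue density of the planar symplectic ensemble of `n` points
with weight `ω`:
`∏_{j<l} |z_j - z_l|² |z_j - z̄_l|² ∏_j |z_j - z̄_j|² ω(z_j)`. -/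
def density {n : ℕ} (ω : ℂ → ℝ) (z : Fin n → ℂ) : ℝ :=
  (∏ j : Fin n, ∏ l ∈ Finset.Ioi j, ‖z j - z l‖ ^ 2 * ‖z j - conj (z l)‖ ^ 2) *
    ∏ j : Fin n, ‖z j - conj (z j)‖ ^ 2 * ω (z j)

/-- The partition function `Z_n` of `n` points for the weight `ω`. -/
def partitionFunction (n : ℕ) (ω : ℂ → ℝ) : ℝ :=
  ∫ z : Fin n → ℂ, density ω z ∂(dAn n)

/-- The Gaussian weight of the GinSE, `ω^(g)(z) = exp (-2|z|²)`. -/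
def weightG (z : ℂ) : ℝ := Real.exp (-2 * ‖z‖ ^ 2)

/-- The overlap weight with conditioning point `x`,
`ω^(over)(z) = |z - x̄|² (1 + |z - x|²) exp (-2|z|²)`. -/
def weightOver (x z : ℂ) : ℝ :=
  ‖z - conj x‖ ^ 2 * (1 + ‖z - x‖ ^ 2) * Real.exp (-2 * ‖z‖ ^ 2)

/-- The generalised mean diagonal overlap `D_{1,1}^{(N,k)}(z_1, …, z_k)`, for `1 ≤ k ≤ N`.
The point `z_1` is the argument `z₁`; the vector `z` lists `z_2, …, z_k`; the vector `w` lists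
the integrated points `z_{k+1}, …, z_N`, so that `Fin.append z w` lists `z_2, …, z_N`. -/
def meanDiagonalOverlap (N k : ℕ) (z₁ : ℂ) (z : Fin (k - 1) → ℂ) : ℝ :=
  ((N.factorial : ℝ) / ((N - k).factorial : ℝ)) * (1 / partitionFunction N weightG) *
    (‖z₁ - conj z₁‖ ^ 2 * Real.exp (-2 * ‖z₁‖ ^ 2)) *
    ∫ w : Fin (N - k) → ℂ, density (weightOver z₁) (Fin.append z w) ∂(dAn (N - k))

/-- The skew product
`⟨f, g⟩ = ∫ (f(z) g(z̄) - g(z) f(z̄)) (z - z̄) ω(z) dA(z)`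
of polynomials. It is bilinear and alternating. When `f` and `g` have real coefficients,
`g(z̄)` and `f(z̄)` are the conjugates of `g(z)` and `f(z)`: see `skewInner_of_real`. -/
def skewInner (ω : ℂ → ℝ) (f g : Polynomial ℂ) : ℂ :=
  ∫ z : ℂ, (f.eval z * g.eval (conj z) - g.eval z * f.eval (conj z)) * (z - conj z) * (ω z : ℂ) ∂dA

theorem eval_conj_of_real (p : Polynomial ℝ) (z : ℂ) :
    (p.map (algebraMap ℝ ℂ)).eval (conj z) = conj ((p.map (algebraMap ℝ ℂ)).eval z) := by
  rw [Polynomial.eval_map_algebraMap, Polynomial.eval_map_algebraMap]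
  exact Polynomial.aeval_conj p z

/-- For polynomials with real coefficients, the skew product is
`∫ (f(z) \overline{g(z)} - g(z) \overline{f(z)}) (z - z̄) ω(z) dA(z)`. -/
theorem skewInner_of_real (ω : ℂ → ℝ) (f g : Polynomial ℝ) :
    skewInner ω (f.map (algebraMap ℝ ℂ)) (g.map (algebraMap ℝ ℂ)) =
      ∫ z : ℂ, ((f.map (algebraMap ℝ ℂ)).eval z * conj ((g.map (algebraMap ℝ ℂ)).eval z) -
        (g.map (algebraMap ℝ ℂ)).eval z * conj ((f.map (algebraMap ℝ ℂ)).eval z)) *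
        (z - conj z) * (ω z : ℂ) ∂dA := by
  simp only [skewInner, eval_conj_of_real]

/-- `q` is a family of planar skew-orthogonal polynomials for the weight `ω`, with positive
skew-norms `r`; the polynomial `q k` has degree `k`. -/
structure IsSkewOrthogonal (ω : ℂ → ℝ) (q : ℕ → Polynomial ℂ) (r : ℕ → ℝ) : Prop where
  degree_eq : ∀ k, (q k).degree = (k : WithBot ℕ)
  norm_pos : ∀ k, 0 < r k
  even_even : ∀ k l, skewInner ω (q (2 * k)) (q (2 * l)) = 0
  odd_odd : ∀ k l, skewInner ω (q (2 * k + 1)) (q (2 * l + 1)) = 0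
  even_odd : ∀ k l, skewInner ω (q (2 * k)) (q (2 * l + 1)) = if k = l then (r k : ℂ) else 0
  odd_even : ∀ k l, skewInner ω (q (2 * l + 1)) (q (2 * k)) = if k = l then -(r k : ℂ) else 0

/-- The skew-kernel
`ϰ_n(z, w) = ∑_{k<n} (q_{2k+1}(z) q_{2k}(w) - q_{2k}(z) q_{2k+1}(w)) / r_k`. -/
def skewKernel (q : ℕ → Polynomial ℂ) (r : ℕ → ℝ) (n : ℕ) (z w : ℂ) : ℂ :=
  ∑ k ∈ Finset.range n,
    ((q (2 * k + 1)).eval z * (q (2 * k)).eval w - (q (2 * k)).eval z * (q (2 * k + 1)).eval w) /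
      (r k : ℂ)

/-- The Pfaffian `(2^n n!)⁻¹ ∑_σ sgn(σ) ∏_i A_{σ(2i-1), σ(2i)}` of a skew-symmetric matrix made of
`n × n` blocks of size `2 × 2`. The index `(i, 0)` stands for row `2i - 1` and `(i, 1)` for
row `2i`. -/
def pfaffian {n : ℕ} (A : Matrix (Fin n × Fin 2) (Fin n × Fin 2) ℂ) : ℂ :=
  ((2 : ℂ) ^ n * (n.factorial : ℂ))⁻¹ *
    ∑ σ : Equiv.Perm (Fin n × Fin 2),
      ((Equiv.Perm.sign σ : ℤ) : ℂ) * ∏ i : Fin n, A (σ (i, 0)) (σ (i, 1))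

/-- The matrix whose `(j, l)` block is
`(K(z_j, z_l), K(z_j, z̄_l); K(z̄_j, z_l), K(z̄_j, z̄_l))`. -/
def kernelMatrix {n : ℕ} (K : ℂ → ℂ → ℂ) (z : Fin n → ℂ) :
    Matrix (Fin n × Fin 2) (Fin n × Fin 2) ℂ :=
  Matrix.of fun a b =>
    !![K (z a.1) (z b.1), K (z a.1) (conj (z b.1));
       K (conj (z a.1)) (z b.1), K (conj (z a.1)) (conj (z b.1))] a.2 b.2

end GinSE

end

namespace GinSE

open Finset Equiv

/-! ### Alternating sums over permutations of pairs -/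

/-! This is de Bruijn's integration method. A Vandermonde determinant at the conjugate pairs `u_1,
ū_1, …, u_n, ū_n` produces the interaction in `density`, so up to leading coefficients the density
is a product of one-point weights times the determinant of `q_0, …, q_{2n-1}` at these points
(`density_mul_leadingCoeff`). In the Leibniz expansion each point occupies its own two columns, so
any set of points can be integrated out factor by factor.

An alternating sum over permutations sees only the antisymmetric part of each factor
(`pairSum_congr`). For an integrated point that part is the skew product, which skew-orthogonality
reduces to a direct sum of 2 × 2 blocks with entries `± r_t`. Integrating out m of k + m points thus
leaves a sum of determinants in which m index pairs are struck out, each weighted by its `r`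
(`integral_density`). With k = 0 this says that the partition function is `n! ∏ r_i`, up to leading
coefficients. For general k, division by `∏ r_i` puts weights `1 / r_i` on the k surviving index
pairs (`sum_det_append_coordinate`), and the result is the expansion of the Pfaffian of the
skew-kernel (`pfaffian_kernelMatrix`). The overlap is such a marginal for N - 1 points.

Existence is skew Gram–Schmidt. An alternating form has no positivity of its own, so the skew-norms
are controlled through the partition functions: positivity of `Z_{n+1}` and of the earlier norms
forces positivity of the next one. -/

/-- The alternating sum `∑_σ sgn(σ) ∏_i B_i(σ(i,0), σ(i,1))` over permutations of `γ × Fin 2`. -/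
def pairSum {γ : Type*} [Fintype γ] [DecidableEq γ] (B : γ → γ × Fin 2 → γ × Fin 2 → ℂ) : ℂ :=
  ∑ σ : Perm (γ × Fin 2), ((Perm.sign σ : ℤ) : ℂ) * ∏ i, B i (σ (i, 0)) (σ (i, 1))

section pairSum

variable {γ : Type*} [Fintype γ] [DecidableEq γ]

/-- Expanding the product of differences gives one term for each choice of swaps inside the pairs.
Composing σ with these swaps absorbs their signs, so all `2 ^ card γ` terms are equal. -/
theorem pairSum_antisymm (B : γ → γ × Fin 2 → γ × Fin 2 → ℂ) :
    pairSum (fun i a b => B i a b - B i b a) = 2 ^ Fintype.card γ * pairSum B := by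
  have key : ∀ (a : Fin 2 → γ × Fin 2) (i : γ), B i (a 0) (a 1) - B i (a 1) (a 0) =
      ∑ τ : Perm (Fin 2), ((Perm.sign τ : ℤ) : ℂ) * B i (a (τ 0)) (a (τ 1)) := by
    intro a i
    rw [show (univ : Finset (Perm (Fin 2))) = {1, swap 0 1} from by decide,
      sum_pair (by decide)]
    simp [sub_eq_add_neg]
  have h1 : ∀ σ : Perm (γ × Fin 2), ∏ i, (B i (σ (i, 0)) (σ (i, 1)) - B i (σ (i, 1)) (σ (i, 0))) =
      ∑ τ : γ → Perm (Fin 2), ((Perm.sign (prodCongrRight τ) : ℤ) : ℂ) *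
        ∏ i, B i ((σ * prodCongrRight τ) (i, 0)) ((σ * prodCongrRight τ) (i, 1)) := by
    intro σ
    calc _ = ∏ i, ∑ τ : Perm (Fin 2),
          ((Perm.sign τ : ℤ) : ℂ) * B i (σ (i, τ 0)) (σ (i, τ 1)) :=
        prod_congr rfl fun i _ => key (fun e => σ (i, e)) i
      _ = _ := by
        rw [Fintype.prod_sum]
        refine sum_congr rfl fun τ _ => ?_
        rw [prod_mul_distrib, Perm.sign_prodCongrRight]
        push_cast
        rfl
  have h2 : ∀ τ : γ → Perm (Fin 2), ∑ σ : Perm (γ × Fin 2), ((Perm.sign σ : ℤ) : ℂ) *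
      (((Perm.sign (prodCongrRight τ) : ℤ) : ℂ) *
        ∏ i, B i ((σ * prodCongrRight τ) (i, 0)) ((σ * prodCongrRight τ) (i, 1))) = pairSum B := by
    intro τ
    refine Fintype.sum_equiv (Equiv.mulRight (prodCongrRight τ)) _ _ fun σ => ?_
    simp only [Equiv.coe_mulRight, Perm.sign_mul]
    push_cast
    ring
  simp only [pairSum, h1, mul_sum] at h2 ⊢
  rw [sum_comm]
  simp only [h2]
  simp [Fintype.card_perm, mul_sum]

/-- This is what lets a matrix of moments be replaced by a simpler matrix with the same skew part.
-/
theorem pairSum_congr {B B' : γ → γ × Fin 2 → γ × Fin 2 → ℂ}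
    (h : ∀ i a b, B i a b - B i b a = B' i a b - B' i b a) : pairSum B = pairSum B' := by
  have := pairSum_antisymm B
  simp only [h, pairSum_antisymm] at this
  exact (mul_left_cancel₀ (pow_ne_zero _ two_ne_zero) this).symm

theorem pairSum_mul (w : γ → ℂ) (B : γ → γ × Fin 2 → γ × Fin 2 → ℂ) :
    pairSum (fun i a b => w i * B i a b) = (∏ i, w i) * pairSum B := by
  simp only [pairSum, prod_mul_distrib, mul_sum]
  exact sum_congr rfl fun σ _ => by ring

theorem pairSum_sum {ι : Type*} [Fintype ι] (F : γ → ι → γ × Fin 2 → γ × Fin 2 → ℂ) :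
    pairSum (fun i a b => ∑ s, F i s a b) = ∑ s : γ → ι, pairSum (fun i => F i (s i)) := by
  simp only [pairSum, Fintype.prod_sum, mul_sum]
  exact sum_comm

/-- Leibniz's formula, with the columns grouped in pairs. -/
theorem pairSum_eq_det (M : Matrix (γ × Fin 2) (γ × Fin 2) ℂ) :
    pairSum (fun i a b => M a (i, 0) * M b (i, 1)) = M.det := by
  simp [pairSum, Matrix.det_apply', Fintype.prod_prod_type]

end pairSum

/-- The Pfaffian of a matrix of the form `Q J Qᵀ`, with `J` a direct sum of `2 × 2` blocks. -/
theorem pfaffian_eq_sum_det {n : ℕ} {ι : Type*} [Fintype ι] (c : ι → ℂ)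
    (Q : Fin n × Fin 2 → ι × Fin 2 → ℂ) :
    pfaffian (Matrix.of fun a b => ∑ s, c s * (Q a (s, 1) * Q b (s, 0) - Q a (s, 0) * Q b (s, 1))) =
      (n.factorial : ℂ)⁻¹ * ∑ s : Fin n → ι, (∏ i, -c (s i)) *
        (Matrix.of fun (a b : Fin n × Fin 2) => Q a (s b.1, b.2)).det := by
  have h : pairSum (fun (_ : Fin n) a b =>
      ∑ s, c s * (Q a (s, 1) * Q b (s, 0) - Q a (s, 0) * Q b (s, 1))) =
      2 ^ n * ∑ s : Fin n → ι, (∏ i, -c (s i)) *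
        (Matrix.of fun (a b : Fin n × Fin 2) => Q a (s b.1, b.2)).det := by
    -- The summand is the antisymmetrisation of `-c s * Q a (s, 0) * Q b (s, 1)`; the resulting
    -- factor `2 ^ n` cancels the one in the definition of the Pfaffian.
    calc _ = pairSum (fun (_ : Fin n) a b => (∑ s, -c s * (Q a (s, 0) * Q b (s, 1))) -
          ∑ s, -c s * (Q b (s, 0) * Q a (s, 1))) := by
          congr 1; funext _ a b
          rw [← sum_sub_distrib]
          exact sum_congr rfl fun s _ => by ring
      _ = _ := by
        rw [pairSum_antisymm (fun (_ : Fin n) a b => ∑ s, -c s * (Q a (s, 0) * Q b (s, 1))),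
          Fintype.card_fin, pairSum_sum]
        congr 1
        refine sum_congr rfl fun s _ => ?_
        rw [pairSum_mul, ← pairSum_eq_det]
        rfl
  simp only [pairSum] at h
  simp only [pfaffian, Matrix.of_apply, h]
  field_simp

/-! ### Counting permutations extending an injection -/

/-- Such permutations form a coset of the pointwise stabiliser of the range of `e`, which is the
symmetric group of the complement. The representative `π₀` is any extension of the bijection between
the two ranges. -/
theorem card_perm_comp_eq {ι β : Type*} [Fintype ι] [DecidableEq ι] [Fintype β] [DecidableEq β]
    {e t : β → ι} (he : Function.Injective e) (ht : Function.Injective t) :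
    #{π : Perm ι | ⇑π ∘ e = t} = (Fintype.card ι - Fintype.card β).factorial := by
  classical
  let φ : {x // x ∈ Set.range e} ≃ {x // x ∈ Set.range t} :=
    (Equiv.ofInjective e he).symm.trans (Equiv.ofInjective t ht)
  let π₀ : Perm ι := φ.extendSubtype
  have hπ₀ : ∀ j, π₀ (e j) = t j := by
    intro j
    have h : e j ∈ Set.range e := ⟨j, rfl⟩
    rw [show π₀ (e j) = φ ⟨e j, h⟩ from Equiv.extendSubtype_apply_of_mem _ _ h]
    have : (⟨e j, h⟩ : {x // x ∈ Set.range e}) = Equiv.ofInjective e he j := rfl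
    simp only [φ, Equiv.trans_apply, this, Equiv.symm_apply_apply]
    rfl
  have h1 : #{π : Perm ι | ⇑π ∘ e = t} =
      Fintype.card {f : Perm ι // ∀ a, ¬ (a ∉ Set.range e) → f a = a} := by
    rw [Fintype.card_subtype]
    refine card_bij (fun π _ => π₀⁻¹ * π) ?_ ?_ ?_
    · intro π hπ
      simp only [mem_filter, mem_univ, true_and, not_not] at hπ ⊢
      rintro _ ⟨j, rfl⟩
      have := congrFun hπ j
      simp only [Function.comp_apply] at this
      rw [Perm.mul_apply, this, ← hπ₀ j]
      exact π₀.symm_apply_apply _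
    · intro a _ b _ h
      exact mul_left_cancel h
    · intro π hπ
      simp only [mem_filter, mem_univ, true_and, not_not] at hπ
      refine ⟨π₀ * π, ?_, by simp⟩
      simp only [mem_filter, mem_univ, true_and]
      funext j
      simp only [Function.comp_apply, Perm.mul_apply]
      rw [hπ _ ⟨j, rfl⟩, hπ₀]
  rw [h1, ← Fintype.card_congr (Perm.subtypeEquivSubtypePerm (fun x => x ∉ Set.range e)),
    Fintype.card_perm, Fintype.card_subtype_compl]
  congr 2
  exact (Fintype.card_congr (Equiv.ofInjective e he)).symm

theorem sum_perm_comp {ι β : Type*} [Fintype ι] [DecidableEq ι] [Fintype β] [DecidableEq β]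
    {e : β → ι} (he : Function.Injective e) (f : (β → ι) → ℂ)
    (hf : ∀ t, ¬ Function.Injective t → f t = 0) :
    ∑ π : Perm ι, f (⇑π ∘ e) = (Fintype.card ι - Fintype.card β).factorial * ∑ t, f t := by
  rw [← sum_fiberwise (s := univ) (g := fun π : Perm ι => ⇑π ∘ e), mul_sum]
  refine sum_congr rfl fun t _ => ?_
  rw [sum_congr rfl (g := fun _ => f t) fun π hπ => by rw [(mem_filter.mp hπ).2]]
  by_cases ht : Function.Injective t
  · rw [sum_const, card_perm_comp_eq he ht, nsmul_eq_mul]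
  · simp [hf t ht]

end GinSE

namespace GinSE
open Finset Equiv

/-! ### Determinants with rows of evaluations and coordinate columns -/

/-- Coordinate columns strike out the rows they point to. Once π has sorted the rows, the matrix is
block lower triangular with an identity block. -/
theorem det_append_coordinate {k m : ℕ} (R : Fin (k + m) × Fin 2 → Fin k → Fin 2 → ℂ)
    (π : Perm (Fin (k + m))) :
    (Matrix.of fun (a b : Fin (k + m) × Fin 2) =>
      Fin.append (R a) (fun j e => if a = (π (Fin.natAdd k j), e) then 1 else 0) b.1 b.2).det =
    (Matrix.of fun (a b : Fin k × Fin 2) => R (π (Fin.castAdd m a.1), a.2) b.1 b.2).det := by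
  set M := Matrix.of fun (a b : Fin (k + m) × Fin 2) =>
      Fin.append (R a) (fun j e => if a = (π (Fin.natAdd k j), e) then (1 : ℂ) else 0) b.1 b.2
    with hM
  let κ : (Fin k × Fin 2) ⊕ (Fin m × Fin 2) ≃ Fin (k + m) × Fin 2 :=
    (Equiv.sumProdDistrib _ _ _).symm.trans (Equiv.prodCongr finSumFinEquiv (Equiv.refl _))
  let ρ : Perm (Fin (k + m) × Fin 2) := Equiv.prodCongrLeft fun _ => π
  -- Both rows of a pair move together, so the sign is that of π squared.
  have hsign : Perm.sign ρ = 1 := by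
    rw [Perm.sign_prodCongrLeft]
    simp
  have h1 : M.det = (M.submatrix ρ id).det := by
    rw [Matrix.det_permute, hsign]; simp
  have h2 : (M.submatrix ρ id).submatrix κ κ = Matrix.fromBlocks
      (Matrix.of fun (a b : Fin k × Fin 2) => R (π (Fin.castAdd m a.1), a.2) b.1 b.2) 0
      (Matrix.of fun (a : Fin m × Fin 2) (b : Fin k × Fin 2) =>
        R (π (Fin.natAdd k a.1), a.2) b.1 b.2) 1 := by
    ext a b
    rcases a with ⟨a, e⟩ | ⟨a, e⟩ <;> rcases b with ⟨b, f⟩ | ⟨b, f⟩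
    · simp [κ, ρ, hM]
    · have : Fin.castAdd m a ≠ Fin.natAdd k b := by
        intro h
        have := congrArg Fin.val h
        have := a.2
        simp at *
        omega
      simp [κ, ρ, hM, this]
    · simp [κ, ρ, hM]
    · simp [κ, ρ, hM, Matrix.one_apply]
  rw [h1, ← Matrix.det_submatrix_equiv_self κ, h2, Matrix.det_fromBlocks_zero₁₂, Matrix.det_one,
    mul_one]

/-- A repeated value of `t` gives equal columns, so only injective `t` contribute, and each extends
to `k!` permutations. -/
theorem sum_det_append_coordinate_eq_sum_perm {k m : ℕ}
    (R : Fin (k + m) × Fin 2 → Fin k → Fin 2 → ℂ) (r : Fin (k + m) → ℂ) :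
    (k.factorial : ℂ) * ∑ t : Fin m → Fin (k + m), (∏ j, r (t j)) *
      (Matrix.of fun (a b : Fin (k + m) × Fin 2) =>
        Fin.append (R a) (fun j e => if a = (t j, e) then 1 else 0) b.1 b.2).det =
    ∑ π : Perm (Fin (k + m)), (∏ j, r (π (Fin.natAdd k j))) *
      (Matrix.of fun (a b : Fin k × Fin 2) => R (π (Fin.castAdd m a.1), a.2) b.1 b.2).det := by
  have hL := sum_perm_comp (e := Fin.natAdd k (m := m)) (Fin.natAdd_injective m k)
    (fun t => (∏ j, r (t j)) * (Matrix.of fun (a b : Fin (k + m) × Fin 2) =>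
        Fin.append (R a) (fun j e => if a = (t j, e) then 1 else 0) b.1 b.2).det) (by
      intro t ht
      simp only [Function.Injective, not_forall] at ht
      obtain ⟨i, j, hij, hne⟩ := ht
      rw [Matrix.det_zero_of_column_eq (i := (Fin.natAdd k i, 0)) (j := (Fin.natAdd k j, 0)),
        mul_zero]
      · simpa using hne
      · intro a
        simp [hij])
  simp only [Fintype.card_fin, Nat.add_sub_cancel] at hL
  rw [← hL]
  exact sum_congr rfl fun π _ => by simp only [Function.comp_apply, det_append_coordinate]

/-- Duality between coordinate columns and selected rows. -/
theorem sum_det_append_coordinate {k m : ℕ} (R : Fin (k + m) × Fin 2 → Fin k → Fin 2 → ℂ)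
    (r : Fin (k + m) → ℂ) (hr : ∀ i, r i ≠ 0) :
    (k.factorial : ℂ) * ∑ t : Fin m → Fin (k + m), (∏ j, r (t j)) *
      (Matrix.of fun (a b : Fin (k + m) × Fin 2) =>
        Fin.append (R a) (fun j e => if a = (t j, e) then 1 else 0) b.1 b.2).det =
    (m.factorial : ℂ) * (∏ i, r i) * ∑ s : Fin k → Fin (k + m), (∏ i, (r (s i))⁻¹) *
      (Matrix.of fun (a b : Fin k × Fin 2) => R (s a.1, a.2) b.1 b.2).det := by
  have hR := sum_perm_comp (e := Fin.castAdd m (n := k)) (Fin.castAdd_injective k m)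
    (fun s => (∏ i, (r (s i))⁻¹) *
      (Matrix.of fun (a b : Fin k × Fin 2) => R (s a.1, a.2) b.1 b.2).det) (by
      intro s hs
      simp only [Function.Injective, not_forall] at hs
      obtain ⟨i, j, hij, hne⟩ := hs
      rw [Matrix.det_zero_of_row_eq (i := (i, 0)) (j := (j, 0)), mul_zero]
      · simpa using hne
      · funext b
        simp [hij])
  simp only [Fintype.card_fin, Nat.add_sub_cancel_left] at hR
  rw [sum_det_append_coordinate_eq_sum_perm, mul_right_comm, ← hR, mul_comm _ (∏ i, r i), mul_sum]
  refine sum_congr rfl fun π _ => ?_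
  simp only [Function.comp_apply]
  rw [← Equiv.prod_comp π r, Fin.prod_univ_add, prod_inv_distrib]
  have : ∏ i : Fin k, r (π (Fin.castAdd m i)) ≠ 0 := prod_ne_zero_iff.mpr fun i _ => hr _
  field_simp

/-! ### The joint density as a determinant -/

/-- The pair `(z, z̄)`. -/
def conjPair (z : ℂ) : Fin 2 → ℂ := ![z, conj z]

/-- Two distinct pairs contribute four differences, which combine into two squared moduli; each pair
contributes its internal difference. -/
theorem prod_Ioi_conjPair {n : ℕ} (u : Fin n → ℂ) :
    ∏ x : Fin (n * 2), ∏ y ∈ Ioi x,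
      (conjPair (u (finProdFinEquiv.symm y).1) (finProdFinEquiv.symm y).2 -
        conjPair (u (finProdFinEquiv.symm x).1) (finProdFinEquiv.symm x).2) =
      (∏ j : Fin n, ∏ l ∈ Ioi j, ((‖u j - u l‖ ^ 2 * ‖u j - conj (u l)‖ ^ 2 : ℝ) : ℂ)) *
        ∏ j : Fin n, (conj (u j) - u j) := by
  -- The enumeration of the 2n points is lexicographic: conjugate partners are adjacent.
  have hlt : ∀ (i j : Fin n) (e f : Fin 2), finProdFinEquiv (i, e) < finProdFinEquiv (j, f) ↔
      i < j ∨ (i = j ∧ e < f) := by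
    intro i j e f
    simp only [Fin.lt_def, finProdFinEquiv_apply_val, Fin.ext_iff]
    omega
  have hIoi : ∀ {k : ℕ} (g : Fin k → ℂ) (x : Fin k),
      ∏ y ∈ Ioi x, g y = ∏ y, if x < y then g y else 1 := by
    intro k g x
    rw [← prod_filter]
    congr 1
    ext; simp
  have hsq : ∀ a b : ℂ, ((‖a - b‖ ^ 2 * ‖a - conj b‖ ^ 2 : ℝ) : ℂ) =
      (b - a) * (conj b - a) * ((b - conj a) * (conj b - conj a)) := by
    intro a b
    push_cast
    rw [← Complex.mul_conj', ← Complex.mul_conj']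
    simp only [map_sub, Complex.conj_conj]
    ring
  simp only [hIoi]
  rw [← Equiv.prod_comp finProdFinEquiv, Fintype.prod_prod_type]
  simp only [← Equiv.prod_comp finProdFinEquiv (fun y => ite _ _ _), Fintype.prod_prod_type,
    Fin.prod_univ_two, Equiv.symm_apply_apply, hlt, ← prod_mul_distrib]
  refine prod_congr rfl fun i _ => ?_
  have hdiag : conj (u i) - u i = ∏ j, if i = j then conj (u j) - u j else 1 := by simp
  rw [hdiag, ← prod_mul_distrib]
  refine prod_congr rfl fun j _ => ?_
  rcases lt_trichotomy i j with h | h | h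
  · simp [h, h.ne, conjPair, hsq]
  · subst h
    simp [conjPair]
  · simp [h.not_gt, h.ne']

/-- The matrix of evaluations of the polynomials `q_0, …, q_{2n-1}` at `u_1, ū_1, …, u_n, ū_n`. -/
def evalMatrix {n : ℕ} (q : ℕ → Polynomial ℂ) (u : Fin n → ℂ) :
    Matrix (Fin n × Fin 2) (Fin n × Fin 2) ℂ :=
  Matrix.of fun a b => (q (2 * a.1 + a.2)).eval (conjPair (u b.1) b.2)

/-- The matrix factors as a Vandermonde matrix times the triangular matrix of coefficients. -/
theorem det_evalMatrix {n : ℕ} (q : ℕ → Polynomial ℂ) (hq : ∀ k < 2 * n, (q k).natDegree = k)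
    (u : Fin n → ℂ) :
    (evalMatrix q u).det = (∏ k ∈ range (2 * n), (q k).leadingCoeff) *
      ((∏ j : Fin n, ∏ l ∈ Ioi j, ((‖u j - u l‖ ^ 2 * ‖u j - conj (u l)‖ ^ 2 : ℝ) : ℂ)) *
        ∏ j : Fin n, (conj (u j) - u j)) := by
  have hq' : ∀ k : Fin (n * 2), (q k).natDegree = k := fun k => hq k (by omega)
  let v : Fin (n * 2) → ℂ := fun x =>
    conjPair (u (finProdFinEquiv.symm x).1) (finProdFinEquiv.symm x).2
  have h1 : (evalMatrix q u).transpose = (Matrix.of fun i (j : Fin (n * 2)) =>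
      (q j).eval (v i)).submatrix finProdFinEquiv finProdFinEquiv := by
    ext a b
    simp only [evalMatrix, Matrix.transpose_apply, Matrix.of_apply, Matrix.submatrix_apply, v,
      Equiv.symm_apply_apply, finProdFinEquiv_apply_val, add_comm]
  rw [← Matrix.det_transpose, h1, Matrix.det_submatrix_equiv_self,
    Matrix.eval_matrixOfPolynomials_eq_vandermonde_mul_matrixOfPolynomials v (fun j => q j)
      (fun i => (hq' i).le), Matrix.det_mul, Matrix.det_vandermonde,
    prod_Ioi_conjPair, mul_comm]
  congr 1
  rw [Matrix.det_of_isUpperTriangular, mul_comm 2 n, ← Fin.prod_univ_eq_prod_range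
    (fun k => (q k).leadingCoeff)]
  · refine prod_congr rfl fun i _ => ?_
    simp [Polynomial.leadingCoeff, hq']
  · intro i j hij
    simp only [Matrix.of_apply]
    apply Polynomial.coeff_eq_zero_of_natDegree_lt
    rw [hq']
    exact hij

theorem density_mul_leadingCoeff {n : ℕ} (ω : ℂ → ℝ) (q : ℕ → Polynomial ℂ)
    (hq : ∀ k < 2 * n, (q k).natDegree = k) (u : Fin n → ℂ) :
    (∏ k ∈ range (2 * n), (q k).leadingCoeff) * (density ω u : ℂ) =
      (∏ i, (u i - conj (u i)) * (ω (u i) : ℂ)) * (evalMatrix q u).det := by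
  -- One factor of `|a - ā|²` comes from the Vandermonde product, the other stays with the weight.
  have hsq : ∀ a : ℂ, ((‖a - conj a‖ : ℝ) : ℂ) ^ 2 = (conj a - a) * (a - conj a) := by
    intro a
    rw [← Complex.mul_conj']
    simp only [map_sub, Complex.conj_conj]
    ring
  rw [det_evalMatrix q hq, density]
  push_cast
  simp only [hsq, mul_assoc, prod_mul_distrib]
  ring

end GinSE

namespace GinSE
open Finset Equiv MeasureTheory

/-! ### Integrating out points -/

/-- All the moments entering the skew product for the weight `ω` are finite. -/
def HasFiniteMoments (ω : ℂ → ℝ) : Prop :=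
  ∀ p q : Polynomial ℂ,
    Integrable (fun z => (z - conj z) * (ω z : ℂ) * (p.eval z * q.eval (conj z))) dA

theorem skewInner_eq_sub {ω : ℂ → ℝ} (hω : HasFiniteMoments ω) (p q : Polynomial ℂ) :
    skewInner ω p q = (∫ z, (z - conj z) * (ω z : ℂ) * (p.eval z * q.eval (conj z)) ∂dA) -
      ∫ z, (z - conj z) * (ω z : ℂ) * (q.eval z * p.eval (conj z)) ∂dA := by
  rw [skewInner, ← integral_sub (hω p q) (hω q p)]
  congr 1; funext z; ring

/-- One factor of the density expanded over permutations. -/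
def pointFactor {n : ℕ} (ω : ℂ → ℝ) (q : ℕ → Polynomial ℂ) (z : ℂ) (a b : Fin n × Fin 2) : ℂ :=
  (z - conj z) * (ω z : ℂ) * ((q (2 * a.1 + a.2)).eval z * (q (2 * b.1 + b.2)).eval (conj z))

theorem density_mul_eq_pairSum {n : ℕ} (ω : ℂ → ℝ) (q : ℕ → Polynomial ℂ)
    (hq : ∀ k < 2 * n, (q k).natDegree = k) (u : Fin n → ℂ) :
    (∏ k ∈ range (2 * n), (q k).leadingCoeff) * (density ω u : ℂ) =
      pairSum fun i => pointFactor ω q (u i) := by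
  rw [density_mul_leadingCoeff ω q hq, ← pairSum_eq_det, ← pairSum_mul]
  rfl

theorem pairSum_append {k m : ℕ}
    (F : Fin k → Fin (k + m) × Fin 2 → Fin (k + m) × Fin 2 → ℂ)
    (G : Fin m → Fin (k + m) × Fin 2 → Fin (k + m) × Fin 2 → ℂ) :
    pairSum (Fin.append F G) = ∑ σ : Perm (Fin (k + m) × Fin 2),
      (((Perm.sign σ : ℤ) : ℂ) *
        ∏ i, F i (σ (Fin.castAdd m i, 0)) (σ (Fin.castAdd m i, 1))) *
        ∏ j, G j (σ (Fin.natAdd k j, 0)) (σ (Fin.natAdd k j, 1)) := by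
  simp only [pairSum, Fin.prod_univ_add, Fin.append_left, Fin.append_right, mul_assoc]

section integration

variable {k m : ℕ} {ω : ℂ → ℝ} (hω : HasFiniteMoments ω) (q : ℕ → Polynomial ℂ) (z : Fin k → ℂ)

theorem pointFactor_append (w : Fin m → ℂ) :
    (fun i : Fin (k + m) => pointFactor (n := k + m) ω q (Fin.append z w i)) =
      Fin.append (fun i => pointFactor ω q (z i)) (fun j => pointFactor ω q (w j)) := by
  funext i
  refine Fin.addCases (fun i => ?_) (fun i => ?_) i <;> simp

include hω

theorem integrable_pairSum :
    Integrable (fun w : Fin m → ℂ =>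
      pairSum fun i : Fin (k + m) => pointFactor ω q (Fin.append z w i)) (dAn m) := by
  simp only [pointFactor_append, pairSum_append]
  exact integrable_finsetSum _ fun σ _ =>
    (Integrable.fintype_prod (f := fun j : Fin m => fun w => pointFactor ω q w
      (σ (Fin.natAdd k j, 0)) (σ (Fin.natAdd k j, 1))) fun j => hω _ _).const_mul _

theorem integral_pairSum :
    ∫ w : Fin m → ℂ, pairSum (fun i : Fin (k + m) => pointFactor ω q (Fin.append z w i)) ∂(dAn m) =
      pairSum (Fin.append (fun i => pointFactor (n := k + m) ω q (z i))
        fun (_ : Fin m) a b => ∫ w, pointFactor ω q w a b ∂dA) := by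
  simp only [pointFactor_append, pairSum_append]
  rw [integral_finsetSum]
  · refine sum_congr rfl fun σ _ => ?_
    rw [integral_const_mul]
    congr 1
    exact integral_fintype_prod_eq_prod (fun j : Fin m => fun w => pointFactor ω q w
      (σ (Fin.natAdd k j, 0)) (σ (Fin.natAdd k j, 1)))
  · exact fun σ _ =>
      (Integrable.fintype_prod (f := fun j : Fin m => fun w => pointFactor ω q w
        (σ (Fin.natAdd k j, 0)) (σ (Fin.natAdd k j, 1))) fun j => hω _ _).const_mul _

end integration

/-- The first `n` pairs of the family `q` are skew-orthogonal, with skew-norms `r`. -/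
def SkewOrthogonalUpTo (ω : ℂ → ℝ) (q : ℕ → Polynomial ℂ) (r : ℕ → ℂ) (n : ℕ) : Prop :=
  ∀ a b : Fin n × Fin 2, skewInner ω (q (2 * a.1 + a.2)) (q (2 * b.1 + b.2)) =
    ∑ t : Fin n, r t * ((if a = (t, 0) then 1 else 0) * (if b = (t, 1) then 1 else 0) -
      (if b = (t, 0) then 1 else 0) * (if a = (t, 1) then 1 else 0))

theorem integral_density {k m : ℕ} {ω : ℂ → ℝ} (hω : HasFiniteMoments ω) {q : ℕ → Polynomial ℂ}
    (hq : ∀ i < 2 * (k + m), (q i).natDegree = i) {r : ℕ → ℂ}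
    (hr : SkewOrthogonalUpTo ω q r (k + m)) (z : Fin k → ℂ) :
    (∏ i ∈ range (2 * (k + m)), (q i).leadingCoeff) *
      ((∫ w : Fin m → ℂ, density ω (Fin.append z w) ∂(dAn m) : ℝ) : ℂ) =
      (∏ i, (z i - conj (z i)) * (ω (z i) : ℂ)) *
        ∑ t : Fin m → Fin (k + m), (∏ j, r (t j)) *
          (Matrix.of fun (a b : Fin (k + m) × Fin 2) =>
            Fin.append (fun i e => (q (2 * a.1 + a.2)).eval (conjPair (z i) e))
              (fun j e => if a = (t j, e) then 1 else 0) b.1 b.2).det := by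
  rw [← integral_complex_ofReal, ← integral_const_mul]
  simp only [density_mul_eq_pairSum ω q hq]
  rw [integral_pairSum hω]
  -- `E t` is half of the elementary skew block; having rank one, it turns each slot into two
  -- coordinate columns, and antisymmetrisation restores the other half.
  let E : Fin (k + m) → Fin (k + m) × Fin 2 → Fin (k + m) × Fin 2 → ℂ := fun t a b =>
    (if a = (t, 0) then 1 else 0) * (if b = (t, 1) then 1 else 0)
  rw [pairSum_congr (B' := Fin.append (fun i => pointFactor (n := k + m) ω q (z i))
        fun (_ : Fin m) a b => ∑ t : Fin (k + m), r t * E t a b)]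
  · have h1 : ∀ t : Fin m → Fin (k + m),
        pairSum (Fin.append (fun i => pointFactor (n := k + m) ω q (z i)) fun j => E (t j)) =
        (∏ i, (z i - conj (z i)) * (ω (z i) : ℂ)) * (Matrix.of fun (a b : Fin (k + m) × Fin 2) =>
            Fin.append (fun i e => (q (2 * a.1 + a.2)).eval (conjPair (z i) e))
              (fun j e => if a = (t j, e) then 1 else 0) b.1 b.2).det := by
      intro t
      rw [← pairSum_eq_det]
      have := pairSum_mul (Fin.append (fun i => (z i - conj (z i)) * (ω (z i) : ℂ))
        fun _ : Fin m => 1) fun i a b =>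
          Fin.append (fun i e => (q (2 * a.1 + a.2)).eval (conjPair (z i) e))
              (fun j e => if a = (t j, e) then 1 else 0) i (0 : Fin 2) *
          Fin.append (fun i e => (q (2 * b.1 + b.2)).eval (conjPair (z i) e))
              (fun j e => if b = (t j, e) then 1 else 0) i (1 : Fin 2)
      rw [Fin.prod_univ_add] at this
      simp only [Fin.append_left, Fin.append_right, prod_const_one, mul_one] at this
      simp only [Matrix.of_apply]
      rw [← this]
      congr 1
      funext i a b
      refine Fin.addCases (fun i => ?_) (fun i => ?_) i <;> simp [E, pointFactor, conjPair]
    rw [pairSum_append]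
    simp only [Fintype.prod_sum, mul_sum]
    rw [sum_comm]
    refine sum_congr rfl fun t _ => ?_
    rw [mul_left_comm, ← h1, pairSum_append, mul_sum]
    refine sum_congr rfl fun σ _ => ?_
    rw [prod_mul_distrib]
    ring
  · intro i a b
    refine Fin.addCases (fun i => ?_) (fun i => ?_) i
    · simp
    · simp only [Fin.append_right]
      rw [← sum_sub_distrib]
      have := hr a b
      rw [skewInner_eq_sub hω] at this
      refine this.trans (sum_congr rfl fun t _ => ?_)
      simp only [E]
      ring

theorem density_cast {a b : ℕ} (h : a = b) (ω : ℂ → ℝ) (u : Fin b → ℂ) :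
    density ω (u ∘ Fin.cast h) = density ω u := by
  subst h; rfl

theorem integrable_density {n : ℕ} {ω : ℂ → ℝ} (hω : HasFiniteMoments ω) :
    Integrable (fun u : Fin n → ℂ => density ω u) (dAn n) := by
  have h := integrable_pairSum (m := n) hω (fun i => Polynomial.X ^ i) (Fin.elim0 : Fin 0 → ℂ)
  simp only [← density_mul_eq_pairSum ω (fun i => (Polynomial.X ^ i : Polynomial ℂ))
    (fun i _ => Polynomial.natDegree_X_pow i), Polynomial.leadingCoeff_X_pow, prod_const_one,
    one_mul, Fin.elim0_append, density_cast] at h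
  simpa using h.re

/-- The partition function is the product of the skew-norms. -/
theorem leadingCoeff_mul_partitionFunction {n : ℕ} {ω : ℂ → ℝ} (hω : HasFiniteMoments ω)
    {q : ℕ → Polynomial ℂ} (hq : ∀ i < 2 * n, (q i).natDegree = i) {r : ℕ → ℂ}
    (hr : SkewOrthogonalUpTo ω q r n) :
    (∏ i ∈ range (2 * n), (q i).leadingCoeff) * (partitionFunction n ω : ℂ) =
      n.factorial * ∏ i ∈ range n, r i := by
  -- All points are integrated: this is the marginal with k = 0 fixed points, where every surviving
  -- determinant is empty.
  obtain ⟨m, rfl⟩ : ∃ m, n = 0 + m := ⟨n, by simp⟩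
  have h := integral_density hω hq hr Fin.elim0
  have h2 := sum_det_append_coordinate_eq_sum_perm (k := 0) (m := m)
    (fun a i e => (q (2 * a.1 + a.2)).eval (conjPair (Fin.elim0 i) e)) (fun i => r i)
  simp only [Nat.factorial_zero, Nat.cast_one, one_mul] at h2
  rw [h2] at h
  simp only [Fin.elim0_append, density_cast, Matrix.det_isEmpty, univ_eq_empty, prod_empty,
    one_mul, mul_one] at h
  have h3 : ∀ π : Perm (Fin (0 + m)), ∏ j : Fin m, r (π (Fin.natAdd 0 j)) =
      ∏ i ∈ range (0 + m), r i := by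
    intro π
    rw [← Fin.prod_univ_eq_prod_range, ← Equiv.prod_comp π, Fin.prod_univ_add]
    simp
  simp only [h3, sum_const, card_univ, Fintype.card_perm, Fintype.card_fin, nsmul_eq_mul] at h
  rw [← h, show partitionFunction (0 + m) ω = partitionFunction m ω by rw [zero_add],
    partitionFunction]

end GinSE

namespace GinSE
open Finset Equiv MeasureTheory

/-! ### The correlation functions as Pfaffians -/

theorem skewInner_swap (ω : ℂ → ℝ) (p q : Polynomial ℂ) :
    skewInner ω p q = -skewInner ω q p := by
  rw [skewInner, skewInner, ← integral_neg]
  congr 1; funext z; ring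

theorem skewInner_self (ω : ℂ → ℝ) (p : Polynomial ℂ) : skewInner ω p p = 0 := by
  simp [skewInner]

theorem skewOrthogonalUpTo_of {ω : ℂ → ℝ} {q : ℕ → Polynomial ℂ} {r : ℕ → ℂ} {n : ℕ}
    (h : ∀ k < n, ∀ l < n, skewInner ω (q (2 * k)) (q (2 * l)) = 0 ∧
      skewInner ω (q (2 * k + 1)) (q (2 * l + 1)) = 0 ∧
      skewInner ω (q (2 * k)) (q (2 * l + 1)) = if k = l then r k else 0) :
    SkewOrthogonalUpTo ω q r n := by
  have heo : ∀ i j : Fin n, skewInner ω (q (2 * i)) (q (2 * j + 1)) =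
      ∑ t : Fin n, r t * ((if i = t then 1 else 0) * (if j = t then 1 else 0)) := by
    intro i j
    rw [(h i i.2 j j.2).2.2]
    by_cases h' : i = j
    · simp [h']
    · simp [h', Fin.val_inj]
  rintro ⟨i, e⟩ ⟨j, f⟩
  fin_cases e <;> fin_cases f
  · simpa using (h i i.2 j j.2).1
  · simpa using heo i j
  · rw [skewInner_swap]
    simpa using heo j i
  · simpa using (h i i.2 j j.2).2.1

theorem IsSkewOrthogonal.upTo {ω : ℂ → ℝ} {q : ℕ → Polynomial ℂ} {r : ℕ → ℝ}
    (h : IsSkewOrthogonal ω q r) (n : ℕ) : SkewOrthogonalUpTo ω q (fun k => (r k : ℂ)) n :=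
  skewOrthogonalUpTo_of fun k _ l _ => ⟨h.even_even k l, h.odd_odd k l, h.even_odd k l⟩

theorem kernelMatrix_skewKernel {k n : ℕ} (q : ℕ → Polynomial ℂ) (r : ℕ → ℝ) (z : Fin k → ℂ) :
    kernelMatrix (skewKernel q r n) z = Matrix.of fun a b => ∑ s : Fin n, ((r s : ℂ))⁻¹ *
      ((q (2 * s + 1)).eval (conjPair (z a.1) a.2) * (q (2 * s)).eval (conjPair (z b.1) b.2) -
        (q (2 * s)).eval (conjPair (z a.1) a.2) *
          (q (2 * s + 1)).eval (conjPair (z b.1) b.2)) := by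
  ext ⟨i, e⟩ ⟨j, f⟩
  have h : kernelMatrix (skewKernel q r n) z (i, e) (j, f) =
      skewKernel q r n (conjPair (z i) e) (conjPair (z j) f) := by
    fin_cases e <;> fin_cases f <;> rfl
  rw [h, skewKernel, ← Fin.sum_univ_eq_sum_range (fun k => ((q (2 * k + 1)).eval
    (conjPair (z i) e) * (q (2 * k)).eval (conjPair (z j) f) - (q (2 * k)).eval (conjPair (z i) e) *
      (q (2 * k + 1)).eval (conjPair (z j) f)) / (r k : ℂ))]
  simp only [Matrix.of_apply]
  exact sum_congr rfl fun s _ => by rw [div_eq_inv_mul]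

/-- The sign `(-1) ^ k` arises because the kernel puts the odd polynomial first; it is matched later
by writing `z̄ - z` in place of `z - z̄`. -/
theorem pfaffian_kernelMatrix {k n : ℕ} (q : ℕ → Polynomial ℂ) (r : ℕ → ℝ) (z : Fin k → ℂ) :
    pfaffian (kernelMatrix (skewKernel q r n) z) = (-1) ^ k * (k.factorial : ℂ)⁻¹ *
      ∑ s : Fin k → Fin n, (∏ i, ((r (s i) : ℂ))⁻¹) * (Matrix.of fun (a b : Fin k × Fin 2) =>
        (q (2 * s a.1 + a.2)).eval (conjPair (z b.1) b.2)).det := by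
  have h := pfaffian_eq_sum_det (n := k) (fun s : Fin n => ((r s : ℂ))⁻¹)
    (fun a b => (q (2 * b.1 + b.2)).eval (conjPair (z a.1) a.2))
  simp only [Fin.val_zero, Fin.val_one, add_zero] at h
  rw [kernelMatrix_skewKernel, h, mul_comm ((-1) ^ k), mul_assoc, mul_sum _ _ ((-1) ^ k)]
  congr 1
  refine sum_congr rfl fun s _ => ?_
  rw [Finset.prod_neg, card_univ, Fintype.card_fin, mul_assoc, ← Matrix.det_transpose]
  rfl

theorem integral_density_eq_pfaffian {k m : ℕ} {ω : ℂ → ℝ} (hω : HasFiniteMoments ω)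
    {q : ℕ → Polynomial ℂ} {r : ℕ → ℝ} (h : IsSkewOrthogonal ω q r) (z : Fin k → ℂ) :
    ((k + m).factorial : ℂ) * ((∫ w : Fin m → ℂ, density ω (Fin.append z w) ∂(dAn m) : ℝ) : ℂ) =
      m.factorial * partitionFunction (k + m) ω *
        (∏ j, (conj (z j) - z j) * (ω (z j) : ℂ)) *
        pfaffian (kernelMatrix (skewKernel q r (k + m)) z) := by
  have hq : ∀ i < 2 * (k + m), (q i).natDegree = i := fun i _ =>
    Polynomial.natDegree_eq_of_degree_eq_some (h.degree_eq i)
  have hI := integral_density hω hq (h.upTo (k + m)) z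
  have hZ := leadingCoeff_mul_partitionFunction hω hq (h.upTo (k + m))
  have hS := sum_det_append_coordinate (k := k) (m := m)
    (fun a i e => (q (2 * a.1 + a.2)).eval (conjPair (z i) e)) (fun i => (r i : ℂ))
    (fun i => by exact_mod_cast (h.norm_pos i).ne')
  have hL : ∏ i ∈ range (2 * (k + m)), (q i).leadingCoeff ≠ 0 := by
    refine prod_ne_zero_iff.mpr fun i _ => Polynomial.leadingCoeff_ne_zero.mpr ?_
    intro h0
    have := h.degree_eq i
    simp [h0] at this
  have hk : (k.factorial : ℂ) ≠ 0 := by exact_mod_cast k.factorial_ne_zero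
  have hsign : ∏ j, (conj (z j) - z j) * (ω (z j) : ℂ) =
      (-1) ^ k * ∏ j, (z j - conj (z j)) * (ω (z j) : ℂ) := by
    have := prod_neg (s := univ) (fun j => (z j - conj (z j)) * (ω (z j) : ℂ))
    simp only [card_univ, Fintype.card_fin] at this
    rw [← this]
    exact prod_congr rfl fun j _ => by ring
  rw [Fin.prod_univ_eq_prod_range (fun i => (r i : ℂ))] at hS
  have hone : ((-1 : ℂ) ^ k) * (-1) ^ k = 1 := by rw [← mul_pow]; simp
  -- `L` is the product of leading coefficients, `I` the marginal, `Z` the partition function, `W`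
  -- the weights, `R` the product of skew-norms, `S` and `T` the dual determinant sums, `e` the
  -- sign; `F`, `K`, `M` are the factorials of k + m, k, m, and `K'` is the inverse of `K`.
  have alg : ∀ {F K K' M Z L I W S T R e : ℂ}, L * I = W * S → L * Z = F * R →
      K * S = M * R * T → e * e = 1 → K * K' = 1 → L * K * (F * I) =
        L * K * (M * Z * (e * W) * (e * K' * T)) := by
    intro F K K' M Z L I W S T R e h1 h2 h3 h4 h5
    linear_combination K * F * h1 + F * W * h3 - M * W * T * h2 -
      M * W * T * L * Z * K * K' * h4 - M * W * T * L * Z * h5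
  rw [pfaffian_kernelMatrix, hsign]
  exact mul_left_cancel₀ (mul_ne_zero hL hk) (alg hI hZ hS hone (mul_inv_cancel₀ hk))

end GinSE

namespace GinSE
open Finset MeasureTheory Function

/-! ### Moments and positivity for the overlap weight -/

theorem integrable_mul_gaussian {f : ℂ → ℂ} (hf : HasTemperateGrowth f) :
    Integrable (fun z => f z * (Real.exp (-2 * ‖z‖ ^ 2) : ℂ)) dA := by
  obtain ⟨M, C, h⟩ := hf.2 0
  have h1 := GaussianFourier.integrable_cexp_neg_mul_sq_norm_add (b := 1) (V := ℂ) (by simp) 0 0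
  have h2 : Integrable (fun z : ℂ => Real.exp (-‖z‖ ^ 2)) dA := by
    refine Integrable.smul_measure ?_ (by simp)
    refine h1.re.congr (Filter.Eventually.of_forall fun z => ?_)
    have : (-1 * (‖z‖ : ℂ) ^ 2 + 0 * ((inner ℝ 0 z : ℝ) : ℂ)) = ((-‖z‖ ^ 2 : ℝ) : ℂ) := by
      push_cast; ring
    beta_reduce
    rw [this, ← Complex.ofReal_exp]
    exact Complex.ofReal_re _
  refine (h2.const_mul (C * (M.factorial * Real.exp 2))).mono' ?_
    (Filter.Eventually.of_forall fun z => ?_)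
  · have := hf.1.continuous
    exact Continuous.aestronglyMeasurable (by fun_prop)
  · have hz := h z
    rw [norm_iteratedFDeriv_zero] at hz
    have hC : 0 ≤ C := by
      by_contra hneg
      have : C * (1 + ‖z‖) ^ M < 0 := mul_neg_of_neg_of_pos (not_le.mp hneg) (by positivity)
      linarith [norm_nonneg (f z)]
    have hpow : (1 + ‖z‖) ^ M ≤ M.factorial * Real.exp (1 + ‖z‖) := by
      have := Real.pow_div_factorial_le_exp (1 + ‖z‖) (by positivity) M
      rwa [div_le_iff₀' (by positivity)] at this
    -- With t = |z| this is 1 + t - 2t² ≤ 2 - t², that is t ≤ 1 + t².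
    have hexp : Real.exp (1 + ‖z‖) * Real.exp (-2 * ‖z‖ ^ 2) ≤
        Real.exp 2 * Real.exp (-‖z‖ ^ 2) := by
      rw [← Real.exp_add, ← Real.exp_add, Real.exp_le_exp]
      nlinarith [sq_nonneg (‖z‖ - 1 / 2)]
    rw [norm_mul, Complex.norm_real, Real.norm_of_nonneg (Real.exp_pos _).le]
    calc _ ≤ C * (M.factorial * Real.exp (1 + ‖z‖)) * Real.exp (-2 * ‖z‖ ^ 2) := by
          gcongr
          exact hz.trans (by gcongr)
      _ = C * M.factorial * (Real.exp (1 + ‖z‖) * Real.exp (-2 * ‖z‖ ^ 2)) := by ring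
      _ ≤ C * M.factorial * (Real.exp 2 * Real.exp (-‖z‖ ^ 2)) := by gcongr
      _ = _ := by ring

theorem hasTemperateGrowth_conj : HasTemperateGrowth (fun z : ℂ => conj z) :=
  Complex.conjCLE.toContinuousLinearMap.hasTemperateGrowth

theorem hasTemperateGrowth_eval (p : Polynomial ℂ) :
    HasTemperateGrowth (fun z : ℂ => p.eval z) := by
  induction p using Polynomial.induction_on' with
  | add p q hp hq => simp only [Polynomial.eval_add]; fun_prop
  | monomial n a => simp only [Polynomial.eval_monomial]; fun_prop

/-- The weight is a polynomial in z and z̄ times a Gaussian. -/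
theorem hasFiniteMoments_weightOver (x : ℂ) : HasFiniteMoments (weightOver x) := by
  intro p q
  have hp := hasTemperateGrowth_eval p
  have hconj := hasTemperateGrowth_conj
  have hq : HasTemperateGrowth (fun z : ℂ => q.eval (conj z)) :=
    (hasTemperateGrowth_eval q).comp hconj
  refine (integrable_mul_gaussian (f := fun z => (z - conj z) *
    ((z - conj x) * (conj z - x) * (1 + (z - x) * (conj z - conj x))) *
    (p.eval z * q.eval (conj z))) (by fun_prop)).congr (Filter.Eventually.of_forall fun z => ?_)
  simp only [weightOver]
  push_cast
  rw [← Complex.mul_conj' (z - conj x), ← Complex.mul_conj' (z - x)]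
  simp only [map_sub, Complex.conj_conj]
  ring

theorem weightOver_nonneg (x z : ℂ) : 0 ≤ weightOver x z := by
  unfold weightOver; positivity

theorem density_nonneg {n : ℕ} {ω : ℂ → ℝ} (hω : ∀ z, 0 ≤ ω z) (u : Fin n → ℂ) :
    0 ≤ density ω u :=
  mul_nonneg (prod_nonneg fun _ _ => prod_nonneg fun _ _ => by positivity)
    (prod_nonneg fun j _ => mul_nonneg (by positivity) (hω _))

theorem exists_density_weightOver_ne_zero (n : ℕ) (x : ℂ) :
    ∃ u : Fin n → ℂ, density (weightOver x) u ≠ 0 := by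
  -- Distinct points on the imaginary axis, above the real line and higher than `x̄`, so that no
  -- factor of the density vanishes.
  let u : Fin n → ℂ := fun j => ⟨0, |x.im| + 1 + j⟩
  have him : ∀ j, (u j).im = |x.im| + 1 + (j : ℕ) := fun j => rfl
  have hpos : ∀ j, 0 < (u j).im := fun j => by rw [him]; positivity
  have hconj : ∀ j l, u j - conj (u l) ≠ 0 := by
    intro j l h
    have := congrArg Complex.im h
    simp only [Complex.sub_im, Complex.conj_im, Complex.zero_im] at this
    linarith [hpos j, hpos l]
  have hx : ∀ j, u j - conj x ≠ 0 := by
    intro j h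
    have := congrArg Complex.im h
    simp only [Complex.sub_im, Complex.conj_im, Complex.zero_im, him] at this
    have h0 : (0 : ℝ) ≤ (j : ℕ) := Nat.cast_nonneg _
    linarith [neg_abs_le x.im]
  refine ⟨u, mul_ne_zero (prod_ne_zero_iff.mpr fun j _ => prod_ne_zero_iff.mpr fun l hl => ?_)
    (prod_ne_zero_iff.mpr fun j _ => ?_)⟩
  · have hne : u j - u l ≠ 0 := by
      intro h
      have := congrArg Complex.im h
      simp only [Complex.sub_im, Complex.zero_im, him] at this
      have h2 : ((j : ℕ) : ℝ) = (l : ℕ) := by linarith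
      exact (mem_Ioi.mp hl).ne (Fin.ext (by exact_mod_cast h2))
    have := norm_ne_zero_iff.mpr hne
    have := norm_ne_zero_iff.mpr (hconj j l)
    positivity
  · have := norm_ne_zero_iff.mpr (hx j)
    have := norm_ne_zero_iff.mpr (hconj j j)
    unfold weightOver
    positivity

theorem continuous_density_weightOver (n : ℕ) (x : ℂ) :
    Continuous (fun u : Fin n → ℂ => density (weightOver x) u) := by
  unfold density weightOver
  fun_prop

instance : dA.IsOpenPosMeasure :=
  Measure.isOpenPosMeasure_smul volume (c := ((NNReal.pi⁻¹ : NNReal) : ENNReal))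
    (by simp [NNReal.pi_ne_zero])

/-- The density is continuous, nonnegative and somewhere nonzero, and the measure charges every
nonempty open set. -/
theorem partitionFunction_weightOver_pos (n : ℕ) (x : ℂ) :
    0 < partitionFunction n (weightOver x) := by
  rw [partitionFunction, integral_pos_iff_support_of_nonneg
    (fun u => density_nonneg (weightOver_nonneg x) u)
    (integrable_density (hasFiniteMoments_weightOver x))]
  have : (dAn n).IsOpenPosMeasure := by unfold dAn; infer_instance
  exact (continuous_density_weightOver n x).isOpen_support.measure_pos _
    (exists_density_weightOver_ne_zero n x)

end GinSE

namespace GinSE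
open Finset MeasureTheory Polynomial

/-! ### Skew Gram–Schmidt orthogonalisation -/

theorem skewInner_sub_left {ω : ℂ → ℝ} (hω : HasFiniteMoments ω) (f g h : ℂ[X]) :
    skewInner ω (f - g) h = skewInner ω f h - skewInner ω g h := by
  simp only [skewInner_eq_sub hω]
  rw [sub_sub_sub_comm, ← integral_sub (hω f h) (hω g h), ← integral_sub (hω h f) (hω h g)]
  congr 2 <;> (funext z; simp only [eval_sub]; ring)

theorem skewInner_smul_left (ω : ℂ → ℝ) (c : ℂ) (f h : ℂ[X]) :
    skewInner ω (c • f) h = c * skewInner ω f h := by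
  rw [skewInner, skewInner, ← integral_const_mul]
  congr 1; funext z; simp only [eval_smul, smul_eq_mul]; ring

theorem skewInner_sum_left {ω : ℂ → ℝ} (hω : HasFiniteMoments ω) {ι : Type*} (s : Finset ι)
    (f : ι → ℂ[X]) (h : ℂ[X]) :
    skewInner ω (∑ i ∈ s, f i) h = ∑ i ∈ s, skewInner ω (f i) h := by
  simp only [skewInner_eq_sub hω, sum_sub_distrib]
  rw [← integral_finsetSum _ fun i _ => hω (f i) h, ← integral_finsetSum _ fun i _ => hω h (f i)]
  congr 2 <;> (funext z; simp only [eval_finsetSum, mul_sum, sum_mul])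

/-- The part of `f` removed to make it skew-orthogonal to the pairs `P 0, …, P (n - 1)`. -/
noncomputable def skewProjection (ω : ℂ → ℝ) (n : ℕ) (P : Fin n → ℂ[X] × ℂ[X]) (f : ℂ[X]) : ℂ[X] :=
  ∑ k, ((skewInner ω f (P k).2 / skewInner ω (P k).1 (P k).2) • (P k).1 -
    (skewInner ω f (P k).1 / skewInner ω (P k).1 (P k).2) • (P k).2)

/-- The pairs of monic polynomials produced by skew Gram–Schmidt orthogonalisation. -/
noncomputable def skewPair (ω : ℂ → ℝ) : ℕ → ℂ[X] × ℂ[X]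
  | n => (X ^ (2 * n) - skewProjection ω n (fun k => skewPair ω k) (X ^ (2 * n)),
      X ^ (2 * n + 1) - skewProjection ω n (fun k => skewPair ω k) (X ^ (2 * n + 1)))
termination_by n => n
decreasing_by all_goals exact k.2

/-- The skew-norms of the family `skewPair`. -/
noncomputable def skewNorm (ω : ℂ → ℝ) (n : ℕ) : ℂ := skewInner ω (skewPair ω n).1 (skewPair ω n).2

/-- The family of monic polynomials produced by skew Gram–Schmidt orthogonalisation. -/
noncomputable def skewPoly (ω : ℂ → ℝ) (n : ℕ) : ℂ[X] :=
  if Even n then (skewPair ω (n / 2)).1 else (skewPair ω (n / 2)).2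

theorem skewPoly_even (ω : ℂ → ℝ) (n : ℕ) : skewPoly ω (2 * n) = (skewPair ω n).1 := by
  simp [skewPoly]

theorem skewPoly_odd (ω : ℂ → ℝ) (n : ℕ) : skewPoly ω (2 * n + 1) = (skewPair ω n).2 := by
  simp [skewPoly, show (2 * n + 1) / 2 = n by omega]

/-- The projection involves only earlier pairs, hence has degree below 2n and leaves the leading
term intact. -/
theorem degree_skewPair (ω : ℂ → ℝ) (n : ℕ) :
    ((skewPair ω n).1.Monic ∧ (skewPair ω n).1.degree = ((2 * n : ℕ) : WithBot ℕ)) ∧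
      (skewPair ω n).2.Monic ∧ (skewPair ω n).2.degree = ((2 * n + 1 : ℕ) : WithBot ℕ) := by
  induction n using Nat.strong_induction_on with
  | _ n ih =>
    have hdeg : ∀ f, (skewProjection ω n (fun k => skewPair ω k) f).degree <
        ((2 * n : ℕ) : WithBot ℕ) := by
      intro f
      refine (degree_lt_iff_coeff_zero _ _).mpr fun i hi => ?_
      rw [skewProjection, finsetSum_coeff]
      refine sum_eq_zero fun k _ => ?_
      obtain ⟨⟨-, h1⟩, -, h2⟩ := ih k k.2
      have hk := k.2
      rw [coeff_sub, coeff_smul, coeff_smul, coeff_eq_zero_of_degree_lt (p := (skewPair ω k).1),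
        coeff_eq_zero_of_degree_lt (p := (skewPair ω k).2)]
      · simp
      · rw [h2]; exact_mod_cast (by omega)
      · rw [h1]; exact_mod_cast (by omega)
    have hdeg' : ∀ f, (skewProjection ω n (fun k => skewPair ω k) f).degree <
        ((2 * n + 1 : ℕ) : WithBot ℕ) := fun f =>
      (hdeg f).trans (by exact_mod_cast Nat.lt_succ_self _)
    rw [skewPair]
    refine ⟨⟨monic_X_pow_sub (hdeg _), ?_⟩, monic_X_pow_sub (hdeg' _), ?_⟩
    · rw [degree_sub_eq_left_of_degree_lt (by rw [degree_X_pow]; exact hdeg _), degree_X_pow]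
    · rw [degree_sub_eq_left_of_degree_lt (by rw [degree_X_pow]; exact hdeg' _), degree_X_pow]

theorem skewPoly_monic_degree (ω : ℂ → ℝ) (n : ℕ) :
    (skewPoly ω n).Monic ∧ (skewPoly ω n).degree = (n : WithBot ℕ) := by
  rcases Nat.even_or_odd' n with ⟨k, rfl | rfl⟩
  · rw [skewPoly_even]; exact (degree_skewPair ω k).1
  · rw [skewPoly_odd]; exact (degree_skewPair ω k).2

/-- Skew-orthogonality relations among the first `n` pairs. -/
def SkewPairRelations (ω : ℂ → ℝ) (n : ℕ) : Prop :=
  ∀ k < n, ∀ l < n, skewInner ω (skewPair ω k).1 (skewPair ω l).1 = 0 ∧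
    skewInner ω (skewPair ω k).2 (skewPair ω l).2 = 0 ∧
    skewInner ω (skewPair ω k).1 (skewPair ω l).2 = if k = l then skewNorm ω k else 0

theorem skewInner_sub_skewProjection {ω : ℂ → ℝ} (hω : HasFiniteMoments ω) {n : ℕ}
    (h : SkewPairRelations ω n) (hne : ∀ k < n, skewNorm ω k ≠ 0) (f : ℂ[X]) {l : ℕ} (hl : l < n) :
    skewInner ω (f - skewProjection ω n (fun k => skewPair ω k) f) (skewPair ω l).1 = 0 ∧
      skewInner ω (f - skewProjection ω n (fun k => skewPair ω k) f) (skewPair ω l).2 = 0 := by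
  have hll := hne l hl
  constructor
  · rw [skewInner_sub_left hω, skewProjection, skewInner_sum_left hω,
      Finset.sum_eq_single (⟨l, hl⟩ : Fin n)]
    · rw [skewInner_sub_left hω, skewInner_smul_left, skewInner_smul_left, skewInner_self,
        skewInner_swap ω (skewPair ω l).2]
      change skewInner ω f (skewPair ω l).1 -
        (_ * 0 - skewInner ω f (skewPair ω l).1 / skewNorm ω l * -skewNorm ω l) = 0
      field_simp
      ring
    · intro k _ hk
      have hkl : l ≠ k := fun h => hk (Fin.ext h.symm)
      rw [skewInner_sub_left hω, skewInner_smul_left, skewInner_smul_left, (h k k.2 l hl).1,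
        skewInner_swap ω (skewPair ω k).2, (h l hl k k.2).2.2, if_neg hkl]
      simp
    · simp
  · rw [skewInner_sub_left hω, skewProjection, skewInner_sum_left hω,
      Finset.sum_eq_single (⟨l, hl⟩ : Fin n)]
    · rw [skewInner_sub_left hω, skewInner_smul_left, skewInner_smul_left, skewInner_self]
      change skewInner ω f (skewPair ω l).2 -
        (skewInner ω f (skewPair ω l).2 / skewNorm ω l * skewNorm ω l - _ * 0) = 0
      field_simp
      ring
    · intro k _ hk
      have hkl : (k : ℕ) ≠ l := fun h => hk (Fin.ext h)
      rw [skewInner_sub_left hω, skewInner_smul_left, skewInner_smul_left, (h k k.2 l hl).2.1,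
        (h k k.2 l hl).2.2, if_neg hkl]
      simp
    · simp

/-- Only the earlier norms are divided by; the norm of the new pair may still vanish here. -/
theorem SkewPairRelations.succ {ω : ℂ → ℝ} (hω : HasFiniteMoments ω) {n : ℕ}
    (h : SkewPairRelations ω n) (hne : ∀ k < n, skewNorm ω k ≠ 0) :
    SkewPairRelations ω (n + 1) := by
  have key : ∀ l < n, (skewInner ω (skewPair ω n).1 (skewPair ω l).1 = 0 ∧
      skewInner ω (skewPair ω n).1 (skewPair ω l).2 = 0) ∧
      skewInner ω (skewPair ω n).2 (skewPair ω l).1 = 0 ∧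
      skewInner ω (skewPair ω n).2 (skewPair ω l).2 = 0 := by
    intro l hl
    rw [skewPair.eq_1 ω n]
    exact ⟨skewInner_sub_skewProjection hω h hne _ hl, skewInner_sub_skewProjection hω h hne _ hl⟩
  intro k hk l hl
  rcases Nat.lt_succ_iff_lt_or_eq.mp hk with hk | rfl <;>
    rcases Nat.lt_succ_iff_lt_or_eq.mp hl with hl | rfl
  · exact h k hk l hl
  · obtain ⟨⟨h1, h2⟩, h3, h4⟩ := key k hk
    rw [skewInner_swap, h1, skewInner_swap, h4, skewInner_swap, h3, if_neg hk.ne]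
    simp
  · obtain ⟨⟨h1, h2⟩, h3, h4⟩ := key l hl
    exact ⟨h1, h4, by rw [h2, if_neg hl.ne']⟩
  · exact ⟨skewInner_self _ _, skewInner_self _ _, by rw [if_pos rfl]; rfl⟩

/-- No norm need be nonzero or real in this identity, so it can be used to determine the last one.
-/
theorem prod_skewNorm {ω : ℂ → ℝ} (hω : HasFiniteMoments ω) {n : ℕ}
    (h : SkewPairRelations ω n) :
    (partitionFunction n ω : ℂ) = n.factorial * ∏ k ∈ range n, skewNorm ω k := by
  have := leadingCoeff_mul_partitionFunction (n := n) (q := skewPoly ω) (r := skewNorm ω) hω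
    (fun i _ => natDegree_eq_of_degree_eq_some (skewPoly_monic_degree ω i).2)
    (skewOrthogonalUpTo_of (by simpa only [skewPoly_even, skewPoly_odd, SkewPairRelations] using h))
  rwa [prod_congr rfl fun i _ => (skewPoly_monic_degree ω i).1.leadingCoeff, prod_const_one,
    one_mul] at this

theorem exists_isSkewOrthogonal {ω : ℂ → ℝ} (hω : HasFiniteMoments ω)
    (hpos : ∀ n, 0 < partitionFunction n ω) :
    ∃ (q : ℕ → ℂ[X]) (r : ℕ → ℝ), IsSkewOrthogonal ω q r := by
  have key : ∀ n, SkewPairRelations ω n ∧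
      ∃ r : ℕ → ℝ, ∀ k < n, skewNorm ω k = r k ∧ 0 < r k := by
    intro n
    induction n with
    | zero => exact ⟨fun k hk => absurd hk (Nat.not_lt_zero k), 0, by simp⟩
    | succ n ih =>
      obtain ⟨hrel, r, hr⟩ := ih
      have hrel' := hrel.succ hω fun k hk => by
        rw [(hr k hk).1]
        exact_mod_cast (hr k hk).2.ne'
      -- The new value is `r_n` solved from `Z_{n+1} = (n+1)! r_0 ⋯ r_n`.
      refine ⟨hrel', Function.update r n
        (partitionFunction (n + 1) ω / ((n + 1).factorial * ∏ k ∈ range n, r k)), ?_⟩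
      have hP : 0 < ∏ k ∈ range n, r k := prod_pos fun k hk => (hr k (mem_range.mp hk)).2
      intro k hk
      rcases Nat.lt_succ_iff_lt_or_eq.mp hk with hk | rfl
      · rw [Function.update_of_ne hk.ne]
        exact hr k hk
      · rw [Function.update_self]
        refine ⟨?_, div_pos (hpos _) (by positivity)⟩
        have hZ := prod_skewNorm hω hrel'
        rw [prod_range_succ, prod_congr rfl fun i hi => (hr i (mem_range.mp hi)).1] at hZ
        have hP' : (∏ i ∈ range k, (r i : ℂ)) ≠ 0 := by exact_mod_cast hP.ne'
        have hF : ((k + 1).factorial : ℂ) ≠ 0 := by exact_mod_cast (k + 1).factorial_ne_zero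
        push_cast
        rw [hZ]
        field_simp
  have hnorm : ∀ n, skewNorm ω n = ((skewNorm ω n).re : ℂ) ∧ 0 < (skewNorm ω n).re := by
    intro n
    obtain ⟨-, r, hr⟩ := key (n + 1)
    obtain ⟨h1, h2⟩ := hr n n.lt_succ_self
    rw [h1]
    simpa using h2
  have hrel : ∀ k l, _ := fun k l =>
    (key (k + l + 1)).1 k (by omega) l (by omega)
  refine ⟨skewPoly ω, fun n => (skewNorm ω n).re, fun n => (skewPoly_monic_degree ω n).2,
    fun n => (hnorm n).2, fun k l => ?_, fun k l => ?_, fun k l => ?_, fun k l => ?_⟩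
  · simpa only [skewPoly_even] using (hrel k l).1
  · simpa only [skewPoly_odd] using (hrel k l).2.1
  · rw [skewPoly_even, skewPoly_odd, (hrel k l).2.2, ← (hnorm k).1]
  · rw [skewPoly_even, skewPoly_odd, skewInner_swap, (hrel k l).2.2, ← (hnorm k).1]
    split_ifs <;> simp

end GinSE

/-! ### The Pfaffian formula for the mean diagonal overlap -/

theorem mainTheorem1 (N : ℕ) (hN : 1 ≤ N) (z₁ : ℂ) :
    GinSE.meanDiagonalOverlap N 1 z₁ ![] =
      N * GinSE.partitionFunction (N - 1) (GinSE.weightOver z₁) /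
          GinSE.partitionFunction N GinSE.weightG *
        (‖z₁ - conj z₁‖ ^ 2 * Real.exp (-2 * ‖z₁‖ ^ 2)) ∧
    (∃ (q : ℕ → Polynomial ℂ) (r : ℕ → ℝ),
      GinSE.IsSkewOrthogonal (GinSE.weightOver z₁) q r) ∧
    ∀ (q : ℕ → Polynomial ℂ) (r : ℕ → ℝ),
      GinSE.IsSkewOrthogonal (GinSE.weightOver z₁) q r →
      ∀ k : ℕ, 2 ≤ k → k ≤ N → ∀ z : Fin (k - 1) → ℂ,
        (GinSE.meanDiagonalOverlap N k z₁ z : ℂ) =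
          ((N * GinSE.partitionFunction (N - 1) (GinSE.weightOver z₁) /
              GinSE.partitionFunction N GinSE.weightG *
            (‖z₁ - conj z₁‖ ^ 2 * Real.exp (-2 * ‖z₁‖ ^ 2)) : ℝ) : ℂ) *
          (∏ j : Fin (k - 1), (conj (z j) - z j) * (GinSE.weightOver z₁ (z j) : ℂ)) *
          GinSE.pfaffian (GinSE.kernelMatrix (GinSE.skewKernel q r (N - 1)) z) := by
  have hω := GinSE.hasFiniteMoments_weightOver z₁
  refine ⟨?_, GinSE.exists_isSkewOrthogonal hω
    fun n => GinSE.partitionFunction_weightOver_pos n z₁, ?_⟩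
  · have h1 : ∀ w : Fin (N - 1) → ℂ,
        GinSE.density (GinSE.weightOver z₁) (Fin.append (![] : Fin (1 - 1) → ℂ) w) =
          GinSE.density (GinSE.weightOver z₁) w := fun w => by
      rw [Fin.append_left_nil _ _ rfl, GinSE.density_cast]
    obtain ⟨M, rfl⟩ : ∃ M, N = M + 1 := ⟨N - 1, by omega⟩
    have hM : (M.factorial : ℝ) ≠ 0 := by exact_mod_cast M.factorial_ne_zero
    simp only [GinSE.meanDiagonalOverlap, h1, Nat.add_sub_cancel,
      Nat.factorial_succ]
    push_cast
    field_simp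
    rfl
  · intro q r h k hk hkN z
    obtain ⟨K, rfl⟩ : ∃ K, k = K + 1 := ⟨k - 1, by omega⟩
    -- Of the N - 1 = K + m points other than `z₁`, K = k - 1 are fixed and m = N - k are
    -- integrated.
    obtain ⟨m, rfl⟩ : ∃ m, N = K + m + 1 := ⟨N - (K + 1), by omega⟩
    change Fin K → ℂ at z
    have hI := GinSE.integral_density_eq_pfaffian (m := m) hω h z
    have hm : K + m + 1 - (K + 1) = m := by omega
    rw [GinSE.meanDiagonalOverlap]
    -- The dimension of the integral equals m only propositionally, so it becomes a variable before
    -- m is eliminated.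
    generalize K + m + 1 - (K + 1) = n at hm ⊢
    subst hm
    simp only [Nat.add_sub_cancel, Nat.factorial_succ]
    have hmi : (n.factorial : ℂ)⁻¹ * n.factorial = 1 :=
      inv_mul_cancel₀ (by exact_mod_cast n.factorial_ne_zero)
    generalize GinSE.pfaffian _ = p at hI ⊢
    have hP : (∏ j : Fin (K + 1 - 1), (conj (z j) - z j) * (GinSE.weightOver z₁ (z j) : ℂ)) =
        ∏ j : Fin K, (conj (z j) - z j) * (GinSE.weightOver z₁ (z j) : ℂ) := rfl
    rw [hP]
    generalize (∏ j : Fin K, (conj (z j) - z j) * (GinSE.weightOver z₁ (z j) : ℂ)) = P at hI ⊢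
    generalize (∫ w : Fin n → ℂ, GinSE.density (GinSE.weightOver z₁) (Fin.append z w) ∂(GinSE.dAn n)) = I at hI ⊢
    generalize GinSE.partitionFunction (K + n + 1) _ = G
    generalize ‖z₁ - conj z₁‖ ^ 2 * Real.exp (-2 * ‖z₁‖ ^ 2) = c
    generalize GinSE.partitionFunction (K + n) _ = Z at hI ⊢
    push_cast at hI ⊢
    -- Since `N! = (K + n + 1) (K + n)!`, this is the marginal identity multiplied by the prefactor;
    -- `G` is a common divisor whose value plays no role.
    linear_combination ((K + n + 1) * c / G / n.factorial : ℂ) * hI +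
      ((K + n + 1) * c * Z / G * P * p) * hmi
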